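/- Let $m\ge 2$, let $P_{m+1}$ be a convex $(m+1)$-gon with vertices $0,1,\dots,m$ in cyclic order, and call the three elements $\mathbf 0=[1:0]$, $\infty=[0:1]$, $\mathbf 1=[1:1]$ of $\mathbb{F}_2\mathbb{P}^1$ colours. Let $$X_{\mathbb{F}_2}(m)=\{(y_0,\dots,y_m)\in(\mathbb{F}_2\mathbb{P}^1)^{m+1} : y_0=\mathbf 0,\ y_m=\infty,\ y_i\ne y_{i+1}\text{ for }0\le i<m\}.$$ Every triangulation $T$ of $P_{m+1}$, viewed as a graph whose edges are the sides of $P_{m+1}$ and the diagonals in $T$, has a unique proper colouring $c(T)=(y_0,\dots,y_m)$ by these three colours with $y_0=\mathbf 0$ and $y_m=\infty$; this defines a map $c$ from the set of triangulations of $P_{m+1}$ to $X_{\mathbb{F}_2}(m)$. A triangulation is a fan triangulation if all its diagonals are incident to one common vertex. A hexagonal move on $T$ is a move of the following kind: choose six vertices of $P_{m+1}$, in cyclic order $v_0,\dots,v_5$ (indices modulo $6$), such that all sides $v_kv_{k+1}$ of the hexagon they span are edges of $T$, and, for some $p$, exchange in this hexagon either the zig-zag $v_p,v_{p+2},v_{p-1},v_{p+3}$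 and the mirror zig-zag $v_p,v_{p-2},v_{p+1},v_{p+3}$ joining the same antipodal vertices (in either direction), or the inscribed triangle $v_pv_{p+2}v_{p+4}$ and the inscribed triangle $v_{p+1}v_{p+3}v_{p+5}$. (a) Let $y=(y_0,\dots,y_m)\in X_{\mathbb{F}_2}(m)$ be such that $y_i=\mathbf 1$ for at least one $i$. Then $\#c^{-1}(y)=1$ if and only if there exists $i\in\{0,\dots,m\}$ such that $y_i\neq y_j$ for every $j\neq i$. (b) Let $T$ be a triangulation of $P_{m+1}$. Then the following are equivalent: no hexagonal move can be applied to $T$; $T$ is a fan triangulation; $\#c^{-1}(c(T))=1$. -/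

import Mathlib

namespace TypeA

/-! ### The projective line and the geometric model -/

/-- The projective line over `F`; its elements are called colours. -/
abbrev PLine (F : Type) [Field F] : Type := Projectivization F (Fin 2 → F)

/-- The colour `0 = [1 : 0]`. -/
def colZero (F : Type) [Field F] : PLine F :=
  Projectivization.mk F ![1, 0] (fun h => one_ne_zero (congrFun h 0))

/-- The colour `∞ = [0 : 1]`. -/
def colInfty (F : Type) [Field F] : PLine F :=
  Projectivization.mk F ![0, 1] (fun h => one_ne_zero (congrFun h 1))

/-- The colour `1 = [1 : 1]`. -/
def colOne (F : Type) [Field F] : PLine F :=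
  Projectivization.mk F ![1, 1] (fun h => one_ne_zero (congrFun h 0))

/-- The set of points of the type A model: tuples `(y_0, …, y_m)` in the projective line with
`y_0 = 0`, `y_m = ∞` and `y_i ≠ y_{i+1}` for `i = 0, …, m - 1`. -/
@[ext] structure Model (F : Type) [Field F] (m : ℕ) where
  color : Fin (m + 1) → PLine F
  color_zero : color 0 = colZero F
  color_last : color (Fin.last m) = colInfty F
  color_ne : ∀ i : Fin m, color i.castSucc ≠ color i.succ

/-! ### Triangulations of the convex polygon with vertices `0, 1, …, m` in cyclic order -/

/-- Sides of the polygon: `{i, i + 1}` and the closing side `{0, m}`. -/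
def IsSide {m : ℕ} (e : Sym2 (Fin (m + 1))) : Prop :=
  ∃ i j : Fin (m + 1), e = s(i, j) ∧ (j.val = i.val + 1 ∨ (i.val = 0 ∧ j.val = m))

/-- Diagonals of the polygon: pairs of distinct vertices that are not sides. -/
def IsDiagonal {m : ℕ} (e : Sym2 (Fin (m + 1))) : Prop :=
  ¬ e.IsDiag ∧ ¬ IsSide e

/-- Two chords of the polygon cross (in their interiors) when their end points alternate. -/
def Crosses {m : ℕ} (e f : Sym2 (Fin (m + 1))) : Prop :=
  ∃ a b c d : Fin (m + 1), a < b ∧ b < c ∧ c < d ∧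
    ((e = s(a, c) ∧ f = s(b, d)) ∨ (e = s(b, d) ∧ f = s(a, c)))

/-- A triangulation is a maximal set of pairwise noncrossing diagonals. -/
@[ext] structure Triangulation (m : ℕ) where
  diags : Finset (Sym2 (Fin (m + 1)))
  isDiagonal : ∀ e ∈ diags, IsDiagonal e
  not_crosses : ∀ e ∈ diags, ∀ f ∈ diags, ¬ Crosses e f
  maximal : ∀ e, IsDiagonal e → (∀ f ∈ diags, ¬ Crosses e f) → e ∈ diags

namespace Triangulation

variable {m : ℕ}

/-- Edges of a triangulation, seen as a graph: its diagonals and the sides of the polygon. -/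
def IsEdge (T : Triangulation m) (e : Sym2 (Fin (m + 1))) : Prop :=
  e ∈ T.diags ∨ IsSide e

/-- A fan triangulation: all diagonals are incident to one vertex. -/
def IsFan (T : Triangulation m) : Prop :=
  ∃ i : Fin (m + 1), ∀ e ∈ T.diags, i ∈ e

/-- `y` colours the graph `T` properly. (The sides of the polygon are properly coloured by every
point of the model.) -/
def IsProperColoring (T : Triangulation m) {F : Type} [Field F] (y : Model F m) : Prop :=
  ∀ i j : Fin (m + 1), T.IsEdge s(i, j) → y.color i ≠ y.color j

end Triangulation

/-! ### Hexagonal moves -/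

/-- In the hexagon with vertices `0, …, 5` (cyclically), the zig-zag
`p, p + 2, p - 1, p + 3` joining the antipodal vertices `p` and `p + 3`. -/
def zigzag (p : Fin 6) : Finset (Sym2 (Fin 6)) :=
  {s(p, p + 2), s(p + 2, p - 1), s(p - 1, p + 3)}

/-- The other (mirror) zig-zag `p, p - 2, p + 1, p + 3` joining `p` and `p + 3`. -/
def zagzig (p : Fin 6) : Finset (Sym2 (Fin 6)) :=
  {s(p, p - 2), s(p - 2, p + 1), s(p + 1, p + 3)}

/-- The inscribed triangle through `p`. -/
def inscribedTriangle (p : Fin 6) : Finset (Sym2 (Fin 6)) :=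
  {s(p, p + 2), s(p + 2, p + 4), s(p + 4, p)}

/-- The pairs of triangulations of the hexagon that are exchanged by the two kinds of moves. -/
def HexPair (A B : Finset (Sym2 (Fin 6))) : Prop :=
  ∃ p : Fin 6, (A = zigzag p ∧ B = zagzig p) ∨ (A = zagzig p ∧ B = zigzag p) ∨
    (A = inscribedTriangle p ∧ B = inscribedTriangle (p + 1))

/-- `T'` is obtained from `T` by a hexagonal move: there is a hexagon, with vertices
`v 0 < ⋯ < v 5` among those of the polygon, whose six sides are edges of `T`, and the triangulation
of this hexagon induced by `T` is replaced by its partner. -/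
def HexMove {m : ℕ} (T T' : Triangulation m) : Prop :=
  ∃ v : Fin 6 → Fin (m + 1), StrictMono v ∧ (∀ k : Fin 6, T.IsEdge s(v k, v (k + 1))) ∧
    ∃ A B : Finset (Sym2 (Fin 6)), HexPair A B ∧
      A.image (Sym2.map v) ⊆ T.diags ∧
      T'.diags = (T.diags \ A.image (Sym2.map v)) ∪ B.image (Sym2.map v)

/-! ### The colouring of a triangulation by the three colours over the field with two elements -/

/-- The field with two elements has exactly three colours. -/
theorem exists_equiv : Nonempty (PLine (ZMod 2) ≃ Fin 3) := by
  have h : Nat.card (PLine (ZMod 2)) = 3 := by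
    rw [Projectivization.card_of_finrank_two (ZMod 2) (Fin 2 → ZMod 2) (by simp)]
    simp
  exact ⟨Nat.equivFinOfCardPos (by omega) |>.trans (finCongr h)⟩

theorem exists_third (a b : PLine (ZMod 2)) : ∃ c, a ≠ c ∧ c ≠ b := by
  obtain ⟨e⟩ := exists_equiv
  have h : ∀ x z : Fin 3, ∃ w, x ≠ w ∧ w ≠ z := by decide
  obtain ⟨w, h1, h2⟩ := h (e a) (e b)
  exact ⟨e.symm w, fun h => h1 (by simp [h]), fun h => h2 (by simp [← h])⟩

theorem third_unique {a b c d : PLine (ZMod 2)} (hab : a ≠ b) (hac : a ≠ c) (hcb : c ≠ b)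
    (had : a ≠ d) (hdb : d ≠ b) : c = d := by
  obtain ⟨e⟩ := exists_equiv
  have h : ∀ x y z w : Fin 3, x ≠ y → x ≠ z → z ≠ y → x ≠ w → w ≠ y → z = w := by decide
  exact e.injective (h (e a) (e b) _ _ (by simpa) (by simpa) (by simpa) (by simpa) (by simpa))

theorem colZero_ne_colInfty (F : Type) [Field F] : colZero F ≠ colInfty F := by
  intro h
  rw [colZero, colInfty, Projectivization.mk_eq_mk_iff'] at h
  obtain ⟨a, ha⟩ := h
  simpa using congrFun ha 0

theorem isSide_iff {m : ℕ} {p q : Fin (m + 1)} (h : p < q) :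
    IsSide s(p, q) ↔ (q.val = p.val + 1 ∨ (p.val = 0 ∧ q.val = m)) := by
  constructor
  · rintro ⟨i, j, he, hs⟩
    rcases Sym2.eq_iff.1 he with ⟨rfl, rfl⟩ | ⟨rfl, rfl⟩ <;> omega
  · exact fun h => ⟨p, q, rfl, h⟩

namespace Triangulation

variable {m : ℕ} (T : Triangulation m)

theorem edge_not_alternate {a b c d : Fin (m + 1)} (hab : a < b) (hbc : b < c) (hcd : c < d)
    (h1 : T.IsEdge s(a, c)) (h2 : T.IsEdge s(b, d)) : False := by
  rcases h1 with h1 | h1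
  · rcases h2 with h2 | h2
    · exact T.not_crosses _ h1 _ h2 ⟨a, b, c, d, hab, hbc, hcd, Or.inl ⟨rfl, rfl⟩⟩
    · rw [isSide_iff (hbc.trans hcd)] at h2; omega
  · rw [isSide_iff (hab.trans hbc)] at h1; omega

theorem exists_apex {i j : Fin (m + 1)} (hij : i.val + 1 < j.val) (h : T.IsEdge s(i, j)) :
    ∃ k, i < k ∧ k < j ∧ T.IsEdge s(i, k) ∧ T.IsEdge s(k, j) := by
  classical
  let S : Finset (Fin (m + 1)) := Finset.univ.filter fun k => i < k ∧ k < j ∧ T.IsEdge s(i, k)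
  have hS : S.Nonempty := by
    refine ⟨⟨i.val + 1, by omega⟩, ?_⟩
    have h0 : i < (⟨i.val + 1, by omega⟩ : Fin (m + 1)) := by simp [Fin.lt_def]
    simp only [S, Finset.mem_filter, Finset.mem_univ, true_and]
    exact ⟨h0, by simpa [Fin.lt_def] using hij, Or.inr ((isSide_iff h0).2 (Or.inl rfl))⟩
  obtain ⟨k, hk, hmax⟩ := S.exists_max_image id hS
  simp only [S, Finset.mem_filter, Finset.mem_univ, true_and, id] at hk hmax
  obtain ⟨hik, hkj, he⟩ := hk
  refine ⟨k, hik, hkj, he, ?_⟩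
  by_cases hs : IsSide s(k, j)
  · exact Or.inr hs
  refine Or.inl (T.maximal _ ⟨by simpa using hkj.ne, hs⟩ ?_)
  rintro f hf ⟨a, b, c, d, hab, hbc, hcd, ⟨h1, rfl⟩ | ⟨h1, rfl⟩⟩
  · rcases Sym2.eq_iff.1 h1 with ⟨rfl, rfl⟩ | ⟨rfl, rfl⟩
    · exact T.edge_not_alternate (hik.trans hab) hbc hcd h (Or.inl hf)
    · omega
  · rcases Sym2.eq_iff.1 h1 with ⟨rfl, rfl⟩ | ⟨rfl, rfl⟩
    · rcases lt_trichotomy a i with hai | rfl | hai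
      · exact T.edge_not_alternate hai (hik.trans hbc) hcd (Or.inl hf) h
      · exact absurd (hmax c ⟨hik.trans hbc, hcd, Or.inl hf⟩) (not_le.2 hbc)
      · exact T.edge_not_alternate hai hab hbc he (Or.inl hf)
    · omega

theorem coloring_exists_aux (n : ℕ) : ∀ i j : Fin (m + 1), j.val - i.val = n → i < j →
    T.IsEdge s(i, j) → ∀ a b : PLine (ZMod 2), a ≠ b →
      ∃ f : Fin (m + 1) → PLine (ZMod 2), f i = a ∧ f j = b ∧
        ∀ p q, i ≤ p → p < q → q ≤ j → T.IsEdge s(p, q) → f p ≠ f q := by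
  induction n using Nat.strong_induction_on with
  | _ n ih =>
    intro i j hn hij h a b hab
    by_cases hlen : i.val + 1 < j.val
    · obtain ⟨k, hik, hkj, h1, h2⟩ := T.exists_apex hlen h
      obtain ⟨c, hac, hcb⟩ := exists_third a b
      obtain ⟨f, fi, fk, hf⟩ := ih (k.val - i.val) (by omega) i k rfl hik h1 a c hac
      obtain ⟨g, gk, gj, hg⟩ := ih (j.val - k.val) (by omega) k j rfl hkj h2 c b hcb
      refine ⟨fun x => if x ≤ k then f x else g x, by simp [hik.le, fi],
        by simp [not_le.2 hkj, gj], ?_⟩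
      intro p q hip hpq hqj hpqe
      dsimp only
      rcases le_or_gt q k with hqk | hqk
      · rw [if_pos (hpq.le.trans hqk), if_pos hqk]
        exact hf p q hip hpq hqk hpqe
      · rw [if_neg (not_le.2 hqk)]
        rcases lt_trichotomy p k with hpk | rfl | hpk
        · rw [if_pos hpk.le]
          rcases hip.lt_or_eq with hip | rfl
          · exact (T.edge_not_alternate hip hpk hqk h1 hpqe).elim
          · rcases hqj.lt_or_eq with hqj | rfl
            · exact (T.edge_not_alternate hik hqk hqj hpqe h2).elim
            · rwa [fi, gj]
        · rw [if_pos le_rfl, fk, ← gk]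
          exact hg p q le_rfl hpq hqj hpqe
        · rw [if_neg (not_le.2 hpk)]
          exact hg p q hpk.le hpq hqj hpqe
    · refine ⟨fun x => if x = i then a else b, by simp, by simp [hij.ne'], ?_⟩
      intro p q hip hpq hqj _
      have hp : p = i := by omega
      have hq : q ≠ i := by omega
      simpa [hp, hq] using hab

theorem coloring_unique_aux (f g : Fin (m + 1) → PLine (ZMod 2))
    (hf : ∀ p q, T.IsEdge s(p, q) → f p ≠ f q) (hg : ∀ p q, T.IsEdge s(p, q) → g p ≠ g q)
    (n : ℕ) : ∀ i j : Fin (m + 1), j.val - i.val = n → i < j → T.IsEdge s(i, j) →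
      f i = g i → f j = g j → ∀ p, i ≤ p → p ≤ j → f p = g p := by
  induction n using Nat.strong_induction_on with
  | _ n ih =>
    intro i j hn hij h hi hj p hip hpj
    by_cases hlen : i.val + 1 < j.val
    · obtain ⟨k, hik, hkj, h1, h2⟩ := T.exists_apex hlen h
      have hk : f k = g k := by
        refine third_unique (hf i j h) (hf i k h1) (hf k j h2) ?_ ?_
        · rw [hi]; exact hg i k h1
        · rw [hj]; exact hg k j h2
      rcases le_total p k with hpk | hpk
      · exact ih (k.val - i.val) (by omega) i k rfl hik h1 hi hk p hip hpk
      · exact ih (j.val - k.val) (by omega) k j rfl hkj h2 hk hj p hpk hpj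
    · rcases (show p = i ∨ p = j by omega) with rfl | rfl <;> assumption

/-- A triangulation has one and only one proper colouring in the model over the field with
two elements. -/
theorem existsUnique_coloring (hm : 2 ≤ m) :
    ∃! y : Model (ZMod 2) m, T.IsProperColoring y := by
  have h0 : (0 : Fin (m + 1)) < Fin.last m := by
    rw [Fin.lt_def]; simp only [Fin.val_zero, Fin.val_last]; omega
  have he : T.IsEdge s(0, Fin.last m) := Or.inr ((isSide_iff h0).2 (Or.inr ⟨rfl, rfl⟩))
  obtain ⟨f, f0, fm, hf⟩ := T.coloring_exists_aux _ 0 (Fin.last m) rfl h0 he _ _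
    (colZero_ne_colInfty (ZMod 2))
  refine ⟨⟨f, f0, fm, fun i => hf _ _ (Fin.zero_le _) i.castSucc_lt_succ (Fin.le_last _)
    (Or.inr ((isSide_iff i.castSucc_lt_succ).2 (Or.inl (by simp))))⟩, ?_, ?_⟩
  · intro p q hpq
    have hne : p ≠ q := by
      rintro rfl
      rcases hpq with h | ⟨i, j, h, hs⟩
      · exact (T.isDiagonal _ h).1 (by simp)
      · rcases Sym2.eq_iff.1 h with ⟨rfl, rfl⟩ | ⟨rfl, rfl⟩ <;> omega
    rcases lt_or_gt_of_ne hne with h | h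
    · exact hf p q (Fin.zero_le _) h (Fin.le_last _) hpq
    · exact (hf q p (Fin.zero_le _) h (Fin.le_last _) (by rwa [Sym2.eq_swap])).symm
  · intro y hy
    ext p : 2
    refine T.coloring_unique_aux y.color f hy ?_ _ 0 (Fin.last m) rfl h0 he
      (y.color_zero.trans f0.symm) (y.color_last.trans fm.symm) p (Fin.zero_le _) (Fin.le_last _)
    intro p q hpq
    have hne : p ≠ q := fun h => hy p q hpq (by rw [h])
    rcases lt_or_gt_of_ne hne with h | h
    · exact hf p q (Fin.zero_le _) h (Fin.le_last _) hpq
    · exact (hf q p (Fin.zero_le _) h (Fin.le_last _) (by rwa [Sym2.eq_swap])).symm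

end Triangulation

/-- The map from triangulations to points: `T` is sent to its unique proper colouring with
`y_0 = 0` and `y_m = ∞`. -/
noncomputable def coloring {m : ℕ} (hm : 2 ≤ m) (T : Triangulation m) : Model (ZMod 2) m :=
  (T.existsUnique_coloring hm).choose

theorem coloring_eq_iff {m : ℕ} (hm : 2 ≤ m) (T : Triangulation m) (y : Model (ZMod 2) m) :
    coloring hm T = y ↔ T.IsProperColoring y := by
  have h := (T.existsUnique_coloring hm).choose_spec
  exact ⟨fun e => e ▸ h.1, fun hy => (h.2 y hy).symm⟩

end TypeA

/-! Everything reduces to fans. In a fan with centre `i`, the vertex `i` is joined to every other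
vertex, so its colour occurs once. Conversely, suppose the colour of `i` occurs once in `y`, and a
diagonal ab of a triangulation properly coloured by `y` misses `i`. The triangle on ab facing away
from `i` has as apex a vertex coloured by the third colour, which is that of `i`: a contradiction.
So the fan at `i` is the only triangulation over `y` (`coloring_preimage_ncard_eq_one`).

Hexagonal moves keep the colouring (`HexMove.coloring_eq`) and change the triangulation
(`HexMove.ne`), so it remains to find a move in every triangulation that is not a fan
(`exists_hexMove_of_not_isFan`). Let `i` have maximal degree, and let ipq be a triangle of the
triangulation with pq a diagonal. If ip and iq are diagonals too, the three neighbouring triangles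
complete ipq to a hexagon with an inscribed triangle. If ip is a side, let r be the apex beyond pq
and s the one beyond qi; iq cannot be a side, since `i` would then have degree 2 and p at least 3.
If si is a diagonal, the triangle beyond it gives a hexagon with a zig-zag; if it is a side, `i` has
degree 3 and q at least 4, against maximality. No move applies to a fan, since the exchanged
diagonals have no common vertex (`HexMove.not_isFan`). -/

namespace TypeA

/-- The cyclic order: going around, `b` is met strictly between `a` and `c`. -/
def Cyclic {n : ℕ} (a b c : Fin n) : Prop :=
  (a < b ∧ b < c) ∨ (b < c ∧ c < a) ∨ (c < a ∧ a < b)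

instance {n : ℕ} (a b c : Fin n) : Decidable (Cyclic a b c) := by
  unfold Cyclic; infer_instance

theorem cyclic_map {n k : ℕ} {v : Fin n → Fin k} (hv : StrictMono v) {a b c : Fin n} :
    Cyclic (v a) (v b) (v c) ↔ Cyclic a b c := by
  simp only [Cyclic, hv.lt_iff_lt]

theorem cyclic_or_cyclic {n : ℕ} {a b c : Fin n} (hab : a ≠ b) (hbc : b ≠ c) (hac : a ≠ c) :
    Cyclic a b c ∨ Cyclic c b a := by
  unfold Cyclic; omega

/-! ### Crossing, sides and diagonals in terms of the cyclic order. -/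

section Crossing

variable {m : ℕ}

/-- The cyclic form needs no labelling of the end points by size, so rotations cost nothing and
incidence arguments become linear arithmetic. -/
theorem crosses_iff {a b c d : Fin (m + 1)} :
    Crosses s(a, b) s(c, d) ↔
      (Cyclic a c b ∧ Cyclic b d a) ∨ (Cyclic a d b ∧ Cyclic b c a) := by
  constructor
  · rintro ⟨x, y, z, w, hxy, hyz, hzw, ⟨h1, h2⟩ | ⟨h1, h2⟩⟩ <;>
      rcases Sym2.eq_iff.1 h1 with ⟨rfl, rfl⟩ | ⟨rfl, rfl⟩ <;>
      rcases Sym2.eq_iff.1 h2 with ⟨rfl, rfl⟩ | ⟨rfl, rfl⟩ <;> unfold Cyclic <;> omega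
  · intro h
    wlog hab : a < b generalizing a b
    · rw [Sym2.eq_swap]
      exact this (by tauto) (by unfold Cyclic at h; omega)
    wlog hcd : c < d generalizing c d
    · rw [Sym2.eq_swap (a := c)]
      exact this (by tauto) (by unfold Cyclic at h; omega)
    by_cases hac : a < c
    · exact ⟨a, c, b, d, hac, by unfold Cyclic at h; omega, by unfold Cyclic at h; omega,
        Or.inl ⟨rfl, rfl⟩⟩
    · exact ⟨c, a, d, b, by unfold Cyclic at h; omega, by unfold Cyclic at h; omega,
        by unfold Cyclic at h; omega, Or.inr ⟨rfl, rfl⟩⟩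

theorem Crosses.symm {e f : Sym2 (Fin (m + 1))} (h : Crosses e f) : Crosses f e := by
  obtain ⟨a, b, c, d, h1, h2, h3, h⟩ := h
  exact ⟨a, b, c, d, h1, h2, h3, by tauto⟩

theorem not_crosses_of_isSide {e f : Sym2 (Fin (m + 1))} (h : IsSide e) : ¬ Crosses e f := by
  rintro ⟨a, b, c, d, h1, h2, h3, ⟨rfl, rfl⟩ | ⟨rfl, rfl⟩⟩
  · rw [isSide_iff (h1.trans h2)] at h; omega
  · rw [isSide_iff (h2.trans h3)] at h; omega

theorem IsSide.ne (hm : 1 ≤ m) {i j : Fin (m + 1)} (h : IsSide s(i, j)) : i ≠ j := by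
  rintro rfl
  obtain ⟨a, b, he, h⟩ := h
  rcases Sym2.eq_iff.1 he with ⟨rfl, rfl⟩ | ⟨rfl, rfl⟩ <;> omega

theorem IsSide.not_cyclic {i j x y : Fin (m + 1)} (h : IsSide s(i, j)) (hx : Cyclic i x j)
    (hy : Cyclic j y i) : False := by
  unfold Cyclic at hx hy
  obtain ⟨a, b, he, h⟩ := h
  rcases Sym2.eq_iff.1 he with ⟨rfl, rfl⟩ | ⟨rfl, rfl⟩ <;> omega

theorem isDiagonal_iff {i j : Fin (m + 1)} :
    IsDiagonal s(i, j) ↔ (∃ x, Cyclic i x j) ∧ ∃ y, Cyclic j y i := by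
  constructor
  · rintro ⟨hd, hs⟩
    have hij : i ≠ j := by simpa using hd
    have key : ∀ {i j : Fin (m + 1)}, i < j → ¬ IsSide s(i, j) →
        (∃ x, Cyclic i x j) ∧ ∃ y, Cyclic j y i := by
      intro i j hij hs
      rw [isSide_iff hij] at hs
      refine ⟨⟨⟨i.val + 1, by omega⟩, ?_⟩, ?_⟩
      · left; simp only [Fin.lt_def]; omega
      -- Beyond j the vertex 0 works, unless i is 0; then m works, because the chord is not the
      -- closing side.
      · by_cases h0 : i.val = 0
        · refine ⟨Fin.last m, ?_⟩
          simp only [Cyclic, Fin.lt_def, Fin.val_last]; omega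
        · refine ⟨⟨0, by omega⟩, ?_⟩
          simp only [Cyclic, Fin.lt_def]; omega
    rcases lt_or_gt_of_ne hij with h | h
    · exact key h hs
    · exact (key h (by rwa [Sym2.eq_swap])).symm
  · rintro ⟨⟨x, hx⟩, y, hy⟩
    refine ⟨?_, fun h => h.not_cyclic hx hy⟩
    rw [Sym2.mk_isDiag_iff]
    rintro rfl
    unfold Cyclic at hx; omega

end Crossing

namespace Triangulation

variable {m : ℕ} (T : Triangulation m)

theorem IsEdge.ne {T : Triangulation m} (hm : 1 ≤ m) {i j : Fin (m + 1)} (h : T.IsEdge s(i, j)) :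
    i ≠ j := by
  rcases h with h | h
  · simpa using (T.isDiagonal _ h).1
  · exact h.ne hm

theorem IsEdge.symm {T : Triangulation m} {i j : Fin (m + 1)} (h : T.IsEdge s(i, j)) :
    T.IsEdge s(j, i) := by
  rwa [Sym2.eq_swap]

theorem IsEdge.not_crosses {T : Triangulation m} {e f : Sym2 (Fin (m + 1))} (he : T.IsEdge e)
    (hf : T.IsEdge f) : ¬ Crosses e f := by
  rcases he with he | he
  · rcases hf with hf | hf
    · exact T.not_crosses _ he _ hf
    · exact fun h => not_crosses_of_isSide hf h.symm
  · exact not_crosses_of_isSide he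

theorem IsEdge.not_cyclic {T : Triangulation m} {a b c d : Fin (m + 1)} (h : T.IsEdge s(a, b))
    (h' : T.IsEdge s(c, d)) (hc : Cyclic a c b) (hd : Cyclic b d a) : False :=
  h.not_crosses h' (crosses_iff.2 (Or.inl ⟨hc, hd⟩))

theorem IsEdge.mem_diags {T : Triangulation m} {a b x y : Fin (m + 1)} (h : T.IsEdge s(a, b))
    (hx : Cyclic a x b) (hy : Cyclic b y a) : s(a, b) ∈ T.diags :=
  h.resolve_right fun h => h.not_cyclic hx hy

theorem isEdge_of_not_crosses {i j : Fin (m + 1)} (hij : i ≠ j)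
    (h : ∀ f ∈ T.diags, ¬ Crosses s(i, j) f) : T.IsEdge s(i, j) := by
  by_cases hs : IsSide s(i, j)
  · exact Or.inr hs
  · exact Or.inl (T.maximal _ ⟨by simpa using hij, hs⟩ h)

theorem isEdge_zero_last (hm : 1 ≤ m) : T.IsEdge s(0, Fin.last m) := by
  have h0 : (0 : Fin (m + 1)) < Fin.last m := by
    rw [Fin.lt_def]; simp only [Fin.val_zero, Fin.val_last]; omega
  exact Or.inr ((isSide_iff h0).2 (Or.inr ⟨rfl, rfl⟩))

/-- Descent on an edge ab enclosing pq: the inner apex of ab cannot lie strictly between p and q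
without an edge crossing pq, so one of the two new edges still encloses pq. The descent ends at a
triangle with pq as a side. -/
theorem exists_outer_apex_aux (n : ℕ) {p q : Fin (m + 1)} (hpq : p < q) (h : T.IsEdge s(p, q)) :
    ∀ a b : Fin (m + 1), b.val - a.val = n → a ≤ p → q ≤ b → (a ≠ p ∨ b ≠ q) →
      T.IsEdge s(a, b) → ∃ k, (k < p ∨ q < k) ∧ T.IsEdge s(p, k) ∧ T.IsEdge s(k, q) := by
  induction n using Nat.strong_induction_on with
  | _ n ih =>
    intro a b hn hap hqb hne hab
    obtain ⟨k, hak, hkb, h1, h2⟩ := T.exists_apex (by omega) hab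
    have hk : k ≤ p ∨ q ≤ k := by
      by_contra! hk
      rcases hap.lt_or_eq with hap' | rfl
      · exact T.edge_not_alternate hap' hk.1 hk.2 h1 h
      · exact T.edge_not_alternate hk.1 hk.2 (by omega) h h2
    rcases hk with hk | hk
    · by_cases hkp : k = p ∧ b = q
      · obtain ⟨rfl, rfl⟩ := hkp
        exact ⟨a, Or.inl hak, h1.symm, hab⟩
      · exact ih _ (by omega) k b rfl hk hqb (by tauto) h2
    · by_cases hkp : a = p ∧ k = q
      · obtain ⟨rfl, rfl⟩ := hkp
        exact ⟨b, Or.inr hkb, hab, h2.symm⟩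
      · exact ih _ (by omega) a k rfl hap hk (by tauto) h1

/-- An edge `ab` with a vertex between `a` and `b` in the cyclic order is the base of a triangle
on that side. -/
theorem IsEdge.exists_apex {T : Triangulation m} {a b x : Fin (m + 1)} (h : T.IsEdge s(a, b))
    (hx : Cyclic a x b) : ∃ k, Cyclic a k b ∧ T.IsEdge s(a, k) ∧ T.IsEdge s(k, b) := by
  by_cases hab : a < b
  · obtain ⟨k, h1, h2, h3⟩ := T.exists_apex (by unfold Cyclic at hx; omega) h
    exact ⟨k, Or.inl ⟨h1, h2⟩, h3⟩
  -- The arc from a to b passes through the closing side, so the descent starts from the edge {0,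
  -- m}.
  · obtain ⟨k, hk, h1, h2⟩ := T.exists_outer_apex_aux _ (by unfold Cyclic at hx; omega) h.symm
      0 (Fin.last m) rfl (Fin.zero_le _) (Fin.le_last _)
      (by unfold Cyclic at hx; simp only [ne_eq, Fin.ext_iff, Fin.val_zero, Fin.val_last]; omega)
      (T.isEdge_zero_last (by unfold Cyclic at hx; omega))
    exact ⟨k, by unfold Cyclic at hx ⊢; omega, h2.symm, h1.symm⟩

/-! ### Fans -/

theorem isEdge_of_fan {i j : Fin (m + 1)} (hi : ∀ e ∈ T.diags, i ∈ e) (hij : i ≠ j) :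
    T.IsEdge s(i, j) := by
  refine T.isEdge_of_not_crosses hij fun f hf h => ?_
  obtain ⟨c, rfl⟩ := hi f hf
  rw [crosses_iff] at h
  unfold Cyclic at h; omega

/-- The fan triangulation at a vertex. -/
noncomputable def fan (i : Fin (m + 1)) : Triangulation m := by
  classical
  exact
  { diags := Finset.univ.filter fun e => i ∈ e ∧ IsDiagonal e
    isDiagonal := fun e he => (Finset.mem_filter.1 he).2.2
    not_crosses := by
      intro e he f hf h
      obtain ⟨c, rfl⟩ := (Finset.mem_filter.1 he).2.1
      obtain ⟨d, rfl⟩ := (Finset.mem_filter.1 hf).2.1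
      rw [crosses_iff] at h
      unfold Cyclic at h; omega
    maximal := by
      intro e he h
      refine Finset.mem_filter.2 ⟨Finset.mem_univ _, ?_, he⟩
      by_contra hi
      induction e using Sym2.ind with
      | _ a b =>
        obtain ⟨⟨x, hx⟩, y, hy⟩ := isDiagonal_iff.1 he
        simp only [Sym2.mem_iff, not_or] at hi
        have hab : a ≠ b := by unfold Cyclic at hx; omega
        -- A diagonal ab missing `i` has a vertex on the side away from `i`; the diagonal from `i`
        -- to it crosses ab.
        rcases cyclic_or_cyclic (Ne.symm hi.1) hi.2 hab with hc | hc
        · exact h s(i, y) (Finset.mem_filter.2 ⟨Finset.mem_univ _, Sym2.mem_mk_left _ _,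
            isDiagonal_iff.2 ⟨⟨b, by unfold Cyclic at *; omega⟩, a, by unfold Cyclic at *; omega⟩⟩)
            (crosses_iff.2 (Or.inl ⟨hc, hy⟩))
        · exact h s(i, x) (Finset.mem_filter.2 ⟨Finset.mem_univ _, Sym2.mem_mk_left _ _,
            isDiagonal_iff.2 ⟨⟨a, by unfold Cyclic at *; omega⟩, b, by unfold Cyclic at *; omega⟩⟩)
            (crosses_iff.2 (Or.inr ⟨hx, hc⟩)) }

theorem mem_of_mem_diags_fan {i : Fin (m + 1)} {e : Sym2 (Fin (m + 1))}
    (he : e ∈ (fan i).diags) : i ∈ e := by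
  simp only [fan, Finset.mem_filter] at he
  exact he.2.1

theorem eq_of_fan {T T' : Triangulation m} {i : Fin (m + 1)} (h : ∀ e ∈ T.diags, i ∈ e)
    (h' : ∀ e ∈ T'.diags, i ∈ e) : T = T' := by
  have key : ∀ {T T' : Triangulation m}, (∀ e ∈ T.diags, i ∈ e) → (∀ e ∈ T'.diags, i ∈ e) →
      T.diags ⊆ T'.diags := by
    intro T T' h h' e he
    obtain ⟨c, rfl⟩ := h e he
    have hd := T.isDiagonal _ he
    exact (T'.isEdge_of_fan h' (by simpa using hd.1)).resolve_right hd.2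
  ext1
  exact (key h h').antisymm (key h' h)

end Triangulation

theorem Model.color_ne_of_isSide {m : ℕ} {F : Type} [Field F] (y : Model F m)
    {i j : Fin (m + 1)} (h : IsSide s(i, j)) : y.color i ≠ y.color j := by
  have key : ∀ i j : Fin (m + 1), (j.val = i.val + 1 ∨ (i.val = 0 ∧ j.val = m)) →
      y.color i ≠ y.color j := by
    rintro i j (hs | ⟨h0, h1⟩)
    · have := y.color_ne ⟨i.val, by omega⟩
      have hj : j = Fin.succ ⟨i.val, by omega⟩ := by ext; simp [hs]
      rw [hj]; exact this
    · have hi : i = 0 := by ext; simpa using h0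
      have hj : j = Fin.last m := by ext; simpa using h1
      rw [hi, hj, y.color_zero, y.color_last]
      exact colZero_ne_colInfty F
  obtain ⟨a, b, he, h⟩ := h
  rcases Sym2.eq_iff.1 he with ⟨rfl, rfl⟩ | ⟨rfl, rfl⟩
  · exact key _ _ h
  · exact (key _ _ h).symm

namespace Triangulation

variable {m : ℕ}

theorem isProperColoring_fan (y : Model (ZMod 2) m) {i : Fin (m + 1)}
    (hi : ∀ j, j ≠ i → y.color i ≠ y.color j) : (fan i).IsProperColoring y := by
  rintro a b (h | h)
  · have hab : a ≠ b := by simpa using ((fan i).isDiagonal _ h).1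
    rcases Sym2.mem_iff.1 (mem_of_mem_diags_fan h) with rfl | rfl
    · exact hi b hab.symm
    · exact (hi a hab).symm
  · exact y.color_ne_of_isSide h

/-- If the colour of the vertex `i` appears only once in a proper colouring, all diagonals are
incident to `i`. -/
theorem IsProperColoring.mem_of_mem_diags {T : Triangulation m} {y : Model (ZMod 2) m}
    (hy : T.IsProperColoring y) {i : Fin (m + 1)} (hi : ∀ j, j ≠ i → y.color i ≠ y.color j)
    {e : Sym2 (Fin (m + 1))} (he : e ∈ T.diags) : i ∈ e := by
  by_contra hie
  -- The apex k on the side away from `i` would have the one colour different from those of a and b,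
  -- that is, the colour of `i`.
  have key : ∀ a b : Fin (m + 1), s(a, b) ∈ T.diags → a ≠ i → b ≠ i → ¬ Cyclic b i a := by
    intro a b h ha hb hc
    obtain ⟨x, hx⟩ := (isDiagonal_iff.1 (T.isDiagonal _ h)).1
    obtain ⟨k, hk, h1, h2⟩ := IsEdge.exists_apex (Or.inl h) hx
    have hki : k ≠ i := by rintro rfl; unfold Cyclic at *; omega
    refine hi k hki (third_unique (hy a b (Or.inl h)) ?_ (hi b hb) (hy a k h1) (hy k b h2))
    exact (hi a ha).symm
  induction e using Sym2.ind with
  | _ a b =>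
    simp only [Sym2.mem_iff, not_or] at hie
    have hab : a ≠ b := by simpa using (T.isDiagonal _ he).1
    rcases cyclic_or_cyclic (Ne.symm hie.1) hie.2 hab with hc | hc
    · exact key b a (by rwa [Sym2.eq_swap]) (Ne.symm hie.2) (Ne.symm hie.1) hc
    · exact key a b he (Ne.symm hie.1) (Ne.symm hie.2) hc

end Triangulation

theorem coloring_preimage_ncard_eq_one {m : ℕ} (hm : 2 ≤ m) {y : Model (ZMod 2) m} {i : Fin (m + 1)}
    (hi : ∀ j, j ≠ i → y.color i ≠ y.color j) : (coloring hm ⁻¹' {y}).ncard = 1 := by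
  rw [Set.ncard_eq_one]
  refine ⟨Triangulation.fan i, Set.eq_singleton_iff_unique_mem.2 ⟨?_, fun T hT => ?_⟩⟩
  · exact (coloring_eq_iff hm _ _).2 (Triangulation.isProperColoring_fan y hi)
  · have hT' := (coloring_eq_iff hm _ _).1 hT
    exact Triangulation.eq_of_fan (fun e he => hT'.mem_of_mem_diags hi he)
      (fun e he => Triangulation.mem_of_mem_diags_fan he)

end TypeA

namespace TypeA

/-! ### Triangulations of the hexagon and their replacement -/

/-- The finite facts about a triangulation of the hexagon by three diagonals. -/
structure IsHexTriangulation (A : Finset (Sym2 (Fin 6))) : Prop where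
  isDiagonal : ∀ a b, s(a, b) ∈ A → a ≠ b ∧ b ≠ a + 1 ∧ a ≠ b + 1
  not_cyclic : ∀ a b, s(a, b) ∈ A → ∀ c d, s(c, d) ∈ A → ¬ (Cyclic a c b ∧ Cyclic b d a)
  maximal : ∀ a b, a ≠ b → b ≠ a + 1 → a ≠ b + 1 →
    s(a, b) ∈ A ∨ ∃ c d, s(c, d) ∈ A ∧ Cyclic a c b ∧ Cyclic b d a

set_option synthInstance.maxSize 1024 in
set_option synthInstance.maxHeartbeats 200000 in
theorem isHexTriangulation_zigzag (p : Fin 6) : IsHexTriangulation (zigzag p) := by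
  constructor <;> revert p <;> decide +kernel

set_option synthInstance.maxSize 1024 in
set_option synthInstance.maxHeartbeats 200000 in
theorem isHexTriangulation_zagzig (p : Fin 6) : IsHexTriangulation (zagzig p) := by
  constructor <;> revert p <;> decide +kernel

set_option synthInstance.maxSize 1024 in
set_option synthInstance.maxHeartbeats 200000 in
theorem isHexTriangulation_inscribedTriangle (p : Fin 6) :
    IsHexTriangulation (inscribedTriangle p) := by
  constructor <;> revert p <;> decide +kernel

theorem HexPair.left {A B : Finset (Sym2 (Fin 6))} (h : HexPair A B) : IsHexTriangulation A := by
  obtain ⟨p, ⟨rfl, -⟩ | ⟨rfl, -⟩ | ⟨rfl, -⟩⟩ := h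
  exacts [isHexTriangulation_zigzag p, isHexTriangulation_zagzig p,
    isHexTriangulation_inscribedTriangle p]

theorem HexPair.right {A B : Finset (Sym2 (Fin 6))} (h : HexPair A B) : IsHexTriangulation B := by
  obtain ⟨p, ⟨-, rfl⟩ | ⟨-, rfl⟩ | ⟨-, rfl⟩⟩ := h
  exacts [isHexTriangulation_zagzig p, isHexTriangulation_zigzag p,
    isHexTriangulation_inscribedTriangle _]

theorem HexPair.disjoint {A B : Finset (Sym2 (Fin 6))} (h : HexPair A B) : Disjoint A B := by
  have h1 : ∀ p, Disjoint (zigzag p) (zagzig p) := by decide +kernel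
  have h2 : ∀ p, Disjoint (inscribedTriangle p) (inscribedTriangle (p + 1)) := by decide +kernel
  obtain ⟨p, ⟨rfl, rfl⟩ | ⟨rfl, rfl⟩ | ⟨rfl, rfl⟩⟩ := h
  exacts [h1 p, (h1 p).symm, h2 p]

section Hexagon

variable {m : ℕ}

theorem mem_image_map_iff {v : Fin 6 → Fin (m + 1)} {A : Finset (Sym2 (Fin 6))}
    {e : Sym2 (Fin (m + 1))} :
    e ∈ A.image (Sym2.map v) ↔ ∃ a b, s(a, b) ∈ A ∧ s(v a, v b) = e := by
  simp only [Finset.mem_image]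
  constructor
  · rintro ⟨f, hf, rfl⟩
    induction f using Sym2.ind with
    | _ a b => exact ⟨a, b, hf, rfl⟩
  · rintro ⟨a, b, hf, rfl⟩
    exact ⟨_, hf, rfl⟩

theorem exists_cyclic_of_notMem_range {v : Fin 6 → Fin (m + 1)} (hv : StrictMono v)
    {x : Fin (m + 1)} (hx : x ∉ Set.range v) : ∃ k, Cyclic (v k) x (v (k + 1)) := by
  by_contra! h
  have h01 : v 0 < v 1 := hv (by decide)
  have h12 : v 1 < v 2 := hv (by decide)
  have h23 : v 2 < v 3 := hv (by decide)
  have h34 : v 3 < v 4 := hv (by decide)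
  have h45 : v 4 < v 5 := hv (by decide)
  have hne : ∀ k, v k ≠ x := fun k hk => hx ⟨k, hk⟩
  have n0 := hne 0
  have n1 := hne 1
  have n2 := hne 2
  have n3 := hne 3
  have n4 := hne 4
  have n5 := hne 5
  have c0 : ¬ Cyclic (v 0) x (v 1) := h 0
  have c1 : ¬ Cyclic (v 1) x (v 2) := h 1
  have c2 : ¬ Cyclic (v 2) x (v 3) := h 2
  have c3 : ¬ Cyclic (v 3) x (v 4) := h 3
  have c4 : ¬ Cyclic (v 4) x (v 5) := h 4
  have c5 : ¬ Cyclic (v 5) x (v 0) := h 5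
  unfold Cyclic at *
  omega

/-- A chord that crosses a chord of a hexagon but none of its sides joins two of its vertices. -/
theorem mem_range_of_crosses {v : Fin 6 → Fin (m + 1)} (hv : StrictMono v) {x y : Fin (m + 1)}
    (hs : ∀ k, ¬ Crosses s(x, y) s(v k, v (k + 1))) {i j : Fin 6}
    (hc : Crosses s(x, y) s(v i, v j)) : x ∈ Set.range v := by
  by_contra hx
  obtain ⟨k, hk⟩ := exists_cyclic_of_notMem_range hv hx
  have hcyc : ∀ k i : Fin 6, ¬ Cyclic k i (k + 1) := by decide
  have hi : ¬ Cyclic (v k) (v i) (v (k + 1)) := fun h => hcyc k i ((cyclic_map hv).1 h)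
  have hj : ¬ Cyclic (v k) (v j) (v (k + 1)) := fun h => hcyc k j ((cyclic_map hv).1 h)
  have hs := hs k
  rw [crosses_iff] at hs hc
  generalize v k = a at *
  generalize v (k + 1) = b at *
  generalize v i = c at *
  generalize v j = d at *
  -- As x lies in the gap cut off by the side ab, y cannot lie beyond that side. All vertices of the
  -- hexagon lie outside the open gap, so no chord cd of it can cross xy.
  have hy : ¬ Cyclic b y a := fun hy =>
    hs (by clear hc hi hj hs; unfold Cyclic at *; omega)
  clear hs
  rcases hc with hc | hc <;> unfold Cyclic at * <;> omega

theorem exists_eq_of_crosses {v : Fin 6 → Fin (m + 1)} (hv : StrictMono v)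
    {e : Sym2 (Fin (m + 1))} (hs : ∀ k, ¬ Crosses e s(v k, v (k + 1))) {i j : Fin 6}
    (hc : Crosses e s(v i, v j)) :
    ∃ a b, e = s(v a, v b) ∧ a ≠ b ∧ b ≠ a + 1 ∧ a ≠ b + 1 := by
  induction e using Sym2.ind with
  | _ x y =>
    obtain ⟨a, rfl⟩ := mem_range_of_crosses hv hs hc
    rw [Sym2.eq_swap] at hs hc
    obtain ⟨b, rfl⟩ := mem_range_of_crosses hv hs hc
    refine ⟨a, b, rfl, ?_, ?_, ?_⟩
    · rintro rfl
      rw [crosses_iff] at hc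
      unfold Cyclic at hc; omega
    · rintro rfl
      have hcyc : ∀ k i : Fin 6, ¬ Cyclic k i (k + 1) := by decide
      rw [crosses_iff] at hc
      simp only [cyclic_map hv, hcyc, and_false, or_false] at hc
    · rintro rfl
      have hcyc : ∀ k i : Fin 6, ¬ Cyclic k i (k + 1) := by decide
      rw [crosses_iff] at hc
      simp only [cyclic_map hv, hcyc, false_and, or_false] at hc

namespace IsHexTriangulation

variable {A : Finset (Sym2 (Fin 6))} {v : Fin 6 → Fin (m + 1)}

theorem not_crosses_image (hA : IsHexTriangulation A) (hv : StrictMono v)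
    {e f : Sym2 (Fin (m + 1))} (he : e ∈ A.image (Sym2.map v)) (hf : f ∈ A.image (Sym2.map v)) :
    ¬ Crosses e f := by
  obtain ⟨a, b, hab, rfl⟩ := mem_image_map_iff.1 he
  obtain ⟨c, d, hcd, rfl⟩ := mem_image_map_iff.1 hf
  rw [crosses_iff]
  simp only [cyclic_map hv]
  rintro (h | h)
  · exact hA.not_cyclic a b hab c d hcd h
  · exact hA.not_cyclic a b hab d c (by rwa [Sym2.eq_swap]) h

theorem mem_image_or_crosses (hA : IsHexTriangulation A) (hv : StrictMono v) {a b : Fin 6}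
    (h1 : a ≠ b) (h2 : b ≠ a + 1) (h3 : a ≠ b + 1) :
    s(v a, v b) ∈ A.image (Sym2.map v) ∨ ∃ f ∈ A.image (Sym2.map v), Crosses s(v a, v b) f := by
  rcases hA.maximal a b h1 h2 h3 with h | ⟨c, d, h, hc⟩
  · exact Or.inl (mem_image_map_iff.2 ⟨a, b, h, rfl⟩)
  · refine Or.inr ⟨_, mem_image_map_iff.2 ⟨c, d, h, rfl⟩, crosses_iff.2 (Or.inl ?_)⟩
    simpa only [cyclic_map hv] using hc

theorem isDiagonal_image (hA : IsHexTriangulation A) (hv : StrictMono v)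
    {e : Sym2 (Fin (m + 1))} (he : e ∈ A.image (Sym2.map v)) : IsDiagonal e := by
  have key : ∀ a b : Fin 6, a ≠ b → b ≠ a + 1 → a ≠ b + 1 → ∃ c d, Cyclic a c b ∧ Cyclic b d a := by
    decide
  obtain ⟨a, b, hab, rfl⟩ := mem_image_map_iff.1 he
  obtain ⟨h1, h2, h3⟩ := hA.isDiagonal a b hab
  obtain ⟨c, d, hc, hd⟩ := key a b h1 h2 h3
  exact isDiagonal_iff.2 ⟨⟨v c, (cyclic_map hv).2 hc⟩, v d, (cyclic_map hv).2 hd⟩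

theorem side_notMem_image (hA : IsHexTriangulation A) (hv : StrictMono v) (k : Fin 6) :
    s(v k, v (k + 1)) ∉ A.image (Sym2.map v) := by
  intro h
  obtain ⟨a, b, h, he⟩ := mem_image_map_iff.1 h
  obtain ⟨h1, h2, h3⟩ := hA.isDiagonal a b h
  rcases Sym2.eq_iff.1 he with ⟨ha, hb⟩ | ⟨ha, hb⟩
  · exact h2 (by rw [hv.injective ha, hv.injective hb])
  · exact h3 (by rw [hv.injective ha, hv.injective hb])

end IsHexTriangulation

/-- A triangulation that contains the sides of a hexagon and one of the triangulations of the
hexagon appearing in the moves admits the corresponding hexagonal move. -/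
theorem exists_hexMove_of_hexPair (T : Triangulation m) {v : Fin 6 → Fin (m + 1)}
    (hv : StrictMono v) (hs : ∀ k, T.IsEdge s(v k, v (k + 1))) {A B : Finset (Sym2 (Fin 6))}
    (h : HexPair A B) (hA : A.image (Sym2.map v) ⊆ T.diags) : ∃ T', HexMove T T' := by
  have hB := h.right
  have hAB : ∀ e ∈ A.image (Sym2.map v), e ∉ B.image (Sym2.map v) := by
    intro e he he'
    rw [Finset.mem_image] at he he'
    obtain ⟨a, ha, rfl⟩ := he
    obtain ⟨b, hb, he⟩ := he'
    rw [Sym2.map.injective hv.injective he] at hb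
    exact Finset.disjoint_left.1 h.disjoint ha hb
  -- A remaining diagonal crossing a new one would be a diagonal of the hexagon, hence in `A` or
  -- crossing a member of `A`.
  have hmix : ∀ e ∈ T.diags \ A.image (Sym2.map v), ∀ f ∈ B.image (Sym2.map v),
      ¬ Crosses e f := by
    intro e he f hf hc
    rw [Finset.mem_sdiff] at he
    obtain ⟨c, d, -, rfl⟩ := mem_image_map_iff.1 hf
    have hside : ∀ k, ¬ Crosses e s(v k, v (k + 1)) := fun k =>
      Triangulation.IsEdge.not_crosses (Or.inl he.1) (hs k)
    obtain ⟨a, b, rfl, h1, h2, h3⟩ := exists_eq_of_crosses hv hside hc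
    rcases h.left.mem_image_or_crosses hv h1 h2 h3 with h' | ⟨f, hf, h'⟩
    · exact he.2 h'
    · exact T.not_crosses _ he.1 _ (hA hf) h'
  refine ⟨⟨(T.diags \ A.image (Sym2.map v)) ∪ B.image (Sym2.map v), ?_, ?_, ?_⟩,
    v, hv, hs, A, B, h, hA, rfl⟩
  · intro e he
    rcases Finset.mem_union.1 he with he | he
    · exact T.isDiagonal e (Finset.mem_sdiff.1 he).1
    · exact hB.isDiagonal_image hv he
  · intro e he f hf
    rcases Finset.mem_union.1 he with he | he <;> rcases Finset.mem_union.1 hf with hf | hf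
    · exact T.not_crosses e (Finset.mem_sdiff.1 he).1 f (Finset.mem_sdiff.1 hf).1
    · exact hmix e he f hf
    · exact fun hc => hmix f hf e he hc.symm
    · exact hB.not_crosses_image hv he hf
  · intro e he hne
    have hside : ∀ k, ¬ Crosses e s(v k, v (k + 1)) := by
      intro k
      rcases hs k with hk | hk
      · exact hne _ (Finset.mem_union_left _
          (Finset.mem_sdiff.2 ⟨hk, h.left.side_notMem_image hv k⟩))
      · exact fun hc => not_crosses_of_isSide hk hc.symm
    -- If `e` crosses `A`, it is a diagonal of the hexagon, and maximality of `B` there applies.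
    -- Otherwise `e` crosses nothing in `T`, so it belongs to `T`; it is not in `A`, as it would
    -- then cross `B`.
    by_cases hcross : ∃ f ∈ A.image (Sym2.map v), Crosses e f
    · obtain ⟨f, hf, hc⟩ := hcross
      obtain ⟨c, d, -, rfl⟩ := mem_image_map_iff.1 hf
      obtain ⟨a, b, rfl, h1, h2, h3⟩ := exists_eq_of_crosses hv hside hc
      rcases hB.mem_image_or_crosses hv h1 h2 h3 with h' | ⟨f, hf, h'⟩
      · exact Finset.mem_union_right _ h'
      · exact absurd h' (hne f (Finset.mem_union_right _ hf))
    · push Not at hcross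
      have heT : e ∈ T.diags := by
        refine T.maximal e he fun f hf => ?_
        by_cases hfA : f ∈ A.image (Sym2.map v)
        · exact hcross f hfA
        · exact hne f (Finset.mem_union_left _ (Finset.mem_sdiff.2 ⟨hf, hfA⟩))
      refine Finset.mem_union_left _ (Finset.mem_sdiff.2 ⟨heT, fun heA => ?_⟩)
      obtain ⟨a, b, hab, rfl⟩ := mem_image_map_iff.1 heA
      obtain ⟨h1, h2, h3⟩ := h.left.isDiagonal a b hab
      rcases hB.mem_image_or_crosses hv h1 h2 h3 with h' | ⟨f, hf, h'⟩
      · exact hAB _ heA h'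
      · exact hne f (Finset.mem_union_right _ hf) h'

theorem HexMove.ne {T T' : Triangulation m} (h : HexMove T T') : T ≠ T' := by
  rintro rfl
  obtain ⟨v, hv, -, A, B, h, hA, hd⟩ := h
  have hne : A.Nonempty := by
    obtain ⟨p, ⟨rfl, -⟩ | ⟨rfl, -⟩ | ⟨rfl, -⟩⟩ := h
    exacts [⟨_, Finset.mem_insert_self _ _⟩, ⟨_, Finset.mem_insert_self _ _⟩,
      ⟨_, Finset.mem_insert_self _ _⟩]
  obtain ⟨a, ha⟩ := hne
  have ha' := Finset.mem_image_of_mem (Sym2.map v) ha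
  have h' := hA ha'
  rw [hd, Finset.mem_union, Finset.mem_sdiff] at h'
  rcases h' with h' | h'
  · exact h'.2 ha'
  · obtain ⟨b, hb, he⟩ := Finset.mem_image.1 h'
    rw [Sym2.map.injective hv.injective he] at hb
    exact Finset.disjoint_left.1 h.disjoint ha hb

/-- No vertex of the hexagon is incident to all three diagonals exchanged by a move. -/
theorem HexPair.exists_notMem {A B : Finset (Sym2 (Fin 6))} (h : HexPair A B) (i : Fin 6) :
    ∃ e ∈ A, i ∉ e := by
  have h1 : ∀ p i, ∃ e ∈ zigzag p, i ∉ e := by decide +kernel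
  have h2 : ∀ p i, ∃ e ∈ zagzig p, i ∉ e := by decide +kernel
  have h3 : ∀ p i, ∃ e ∈ inscribedTriangle p, i ∉ e := by decide +kernel
  obtain ⟨p, ⟨rfl, -⟩ | ⟨rfl, -⟩ | ⟨rfl, -⟩⟩ := h
  exacts [h1 p i, h2 p i, h3 p i]

theorem HexMove.not_isFan {T T' : Triangulation m} (h : HexMove T T') : ¬ T.IsFan := by
  rintro ⟨i, hi⟩
  obtain ⟨v, hv, -, A, B, h, hA, -⟩ := h
  obtain ⟨e₀, he₀, -⟩ := h.exists_notMem 0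
  obtain ⟨j, -, rfl⟩ := Sym2.mem_map.1 (hi _ (hA (Finset.mem_image_of_mem _ he₀)))
  obtain ⟨e, he, hj⟩ := h.exists_notMem j
  obtain ⟨k, hk, hkj⟩ := Sym2.mem_map.1 (hi _ (hA (Finset.mem_image_of_mem _ he)))
  exact hj (hv.injective hkj ▸ hk)

/-! ### Moves preserve the colouring -/

set_option synthInstance.maxSize 1024 in
set_option synthInstance.maxHeartbeats 200000 in
-- Three colours leave no freedom in a triangulated hexagon. A zig-zag from p to p + 3 forces equal
-- colours at p ± 1, at p ± 2, and at p and p + 3, a pattern fixed by the reflection exchanging the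
-- zig-zags. An inscribed triangle forces equal colours at antipodal vertices, a pattern fixed by
-- the half-turn exchanging the triangles. The finite checks `dec1` and `dec2` record this.
theorem HexPair.ne_of_mem {A B : Finset (Sym2 (Fin 6))} (h : HexPair A B)
    {f : Fin 6 → PLine (ZMod 2)} (hs : ∀ k, f k ≠ f (k + 1))
    (hA : ∀ a b, s(a, b) ∈ A → f a ≠ f b) {a b : Fin 6} (hab : s(a, b) ∈ B) : f a ≠ f b := by
  have hs' : ∀ k, f (k + 1) ≠ f k := fun k => (hs k).symm
  obtain ⟨e⟩ := exists_equiv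
  have dec1 : ∀ a b c d x y : Fin 3, a ≠ b → b ≠ c → c ≠ d → d ≠ x → x ≠ y → y ≠ a →
      a ≠ c → c ≠ y → y ≠ d → a ≠ x ∧ x ≠ b ∧ b ≠ d := by decide +kernel
  have dec2 : ∀ a b c d x y : Fin 3, a ≠ b → b ≠ c → c ≠ d → d ≠ x → x ≠ y → y ≠ a →
      a ≠ c → c ≠ x → x ≠ a → b ≠ d ∧ d ≠ y ∧ y ≠ b := by decide +kernel
  have key : ∀ {u v : Fin 6}, f u ≠ f v → s(a, b) = s(u, v) → f a ≠ f b := by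
    intro u v h he
    rcases Sym2.eq_iff.1 he with ⟨rfl, rfl⟩ | ⟨rfl, rfl⟩
    exacts [h, h.symm]
  have tr : ∀ {x y : Fin 6}, f x ≠ f y → e (f x) ≠ e (f y) := fun h h' => h (e.injective h')
  have tr' : ∀ {x y : Fin 6}, e (f x) ≠ e (f y) → f x ≠ f y := fun h h' => h (by rw [h'])
  have side : ∀ x y : Fin 6, (y = x + 1 ∨ x = y + 1) → e (f x) ≠ e (f y) := by
    rintro x y (rfl | rfl)
    exacts [tr (hs x), tr (hs' y)]
  obtain ⟨p, ⟨rfl, rfl⟩ | ⟨rfl, rfl⟩ | ⟨rfl, rfl⟩⟩ := h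
  · have := dec1 (e (f p)) (e (f (p + 1))) (e (f (p + 2))) (e (f (p + 3))) (e (f (p - 2)))
      (e (f (p - 1))) (side _ _ (by grind)) (side _ _ (by grind)) (side _ _ (by grind))
      (side _ _ (by grind)) (side _ _ (by grind)) (side _ _ (by grind))
      (tr (hA _ _ (by simp [zigzag]))) (tr (hA _ _ (by simp [zigzag])))
      (tr (hA _ _ (by simp [zigzag])))
    simp only [zagzig, Finset.mem_insert, Finset.mem_singleton] at hab
    rcases hab with hab | hab | hab
    exacts [key (tr' this.1) hab, key (tr' this.2.1) hab, key (tr' this.2.2) hab]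
  -- Read backwards from p, the mirror zig-zag is a zig-zag.
  · have := dec1 (e (f p)) (e (f (p - 1))) (e (f (p - 2))) (e (f (p + 3))) (e (f (p + 2)))
      (e (f (p + 1))) (side _ _ (by grind)) (side _ _ (by grind)) (side _ _ (by grind))
      (side _ _ (by grind)) (side _ _ (by grind)) (side _ _ (by grind))
      (tr (hA _ _ (by simp [zagzig]))) (tr (hA _ _ (by simp [zagzig])))
      (tr (hA _ _ (by simp [zagzig])))
    simp only [zigzag, Finset.mem_insert, Finset.mem_singleton] at hab
    rcases hab with hab | hab | hab
    exacts [key (tr' this.1) hab, key (tr' this.2.1) hab, key (tr' this.2.2) hab]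
  · have := dec2 (e (f p)) (e (f (p + 1))) (e (f (p + 2))) (e (f (p + 1 + 2))) (e (f (p + 4)))
      (e (f (p + 1 + 4))) (side _ _ (by grind)) (side _ _ (by grind)) (side _ _ (by grind))
      (side _ _ (by grind)) (side _ _ (by grind)) (side _ _ (by grind))
      (tr (hA _ _ (by simp [inscribedTriangle]))) (tr (hA _ _ (by simp [inscribedTriangle])))
      (tr (hA _ _ (by simp [inscribedTriangle])))
    simp only [inscribedTriangle, Finset.mem_insert, Finset.mem_singleton] at hab
    rcases hab with hab | hab | hab
    exacts [key (tr' this.1) hab, key (tr' this.2.1) hab, key (tr' this.2.2) hab]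

theorem HexMove.coloring_eq (hm : 2 ≤ m) {T T' : Triangulation m} (h : HexMove T T') :
    coloring hm T' = coloring hm T := by
  rw [coloring_eq_iff]
  have hy := (coloring_eq_iff hm T _).1 rfl
  obtain ⟨v, hv, hs, A, B, h, hA, hd⟩ := h
  rintro i j (hij | hij)
  · rw [hd, Finset.mem_union] at hij
    rcases hij with hij | hij
    · exact hy i j (Or.inl (Finset.mem_sdiff.1 hij).1)
    · obtain ⟨a, b, hab, he⟩ := mem_image_map_iff.1 hij
      have := h.ne_of_mem (f := fun k => (coloring hm T).color (v k)) (fun k => hy _ _ (hs k))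
        (fun a b hab => hy _ _ (Or.inl (hA (mem_image_map_iff.2 ⟨a, b, hab, rfl⟩)))) hab
      rcases Sym2.eq_iff.1 he with ⟨rfl, rfl⟩ | ⟨rfl, rfl⟩
      exacts [this, this.symm]
  · exact hy i j (Or.inr hij)

end Hexagon

end TypeA

namespace TypeA

/-! ### Finding a hexagonal move in a triangulation that is not a fan -/

section Rotation

variable {m : ℕ}

/-- A cyclically ordered hexagon becomes increasing after a rotation. -/
theorem exists_strictMono_rotation {w : Fin 6 → Fin (m + 1)}
    (hw : ∀ i j k, Cyclic i j k → Cyclic (w i) (w j) (w k)) :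
    ∃ r, StrictMono fun k => w (k + r) := by
  obtain ⟨r, -, hr⟩ := Finset.univ.exists_min_image w Finset.univ_nonempty
  have h1 : ∀ r k l : Fin 6, 0 < k → k < l → Cyclic r (k + r) (l + r) := by decide
  have h2 : ∀ r k : Fin 6, 0 < k → ∃ x, Cyclic r (k + r) x ∨ Cyclic r x (k + r) := by decide
  have key : ∀ k : Fin 6, 0 < k → w r < w (k + r) := by
    intro k hk
    have := hr (k + r) (Finset.mem_univ _)
    obtain ⟨x, hx | hx⟩ := h2 r k hk
    all_goals
      have := hw _ _ _ hx
      unfold Cyclic at this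
      omega
  refine ⟨r, fun k l hkl => ?_⟩
  rcases (Fin.zero_le k).lt_or_eq with hk | rfl
  · have := hw _ _ _ (h1 r k l hk hkl)
    have := key k hk
    have := key l (hk.trans hkl)
    unfold Cyclic at *
    dsimp only
    omega
  · simpa using key l hkl

/-- The zig-zags and inscribed triangles that occur in hexagonal moves. -/
def IsMovable (A : Finset (Sym2 (Fin 6))) : Prop := ∃ B, HexPair A B

/-- Hexagons are found from an arbitrary starting vertex, while `HexMove` lists their vertices
increasingly; the shift must preserve the type of pattern. -/
theorem IsMovable.rotate {A : Finset (Sym2 (Fin 6))} (hA : IsMovable A) (r : Fin 6) :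
    IsMovable (A.image (Sym2.map (· - r))) := by
  have h1 : ∀ p r, (zigzag p).image (Sym2.map (· - r)) = zigzag (p - r) := by decide +kernel
  have h2 : ∀ p r, (zagzig p).image (Sym2.map (· - r)) = zagzig (p - r) := by decide +kernel
  have h3 : ∀ p r, (inscribedTriangle p).image (Sym2.map (· - r)) = inscribedTriangle (p - r) := by
    decide +kernel
  obtain ⟨B, p, ⟨rfl, -⟩ | ⟨rfl, -⟩ | ⟨rfl, -⟩⟩ := hA
  · exact ⟨_, p - r, Or.inl ⟨h1 p r, rfl⟩⟩
  · exact ⟨_, p - r, Or.inr (Or.inl ⟨h2 p r, rfl⟩)⟩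
  · exact ⟨_, p - r, Or.inr (Or.inr ⟨h3 p r, rfl⟩)⟩

theorem exists_hexMove_of_isMovable (T : Triangulation m) {w : Fin 6 → Fin (m + 1)}
    (hw : ∀ i j k, Cyclic i j k → Cyclic (w i) (w j) (w k))
    (hs : ∀ k, T.IsEdge s(w k, w (k + 1))) {A : Finset (Sym2 (Fin 6))} (hA : IsMovable A)
    (h : ∀ a b, s(a, b) ∈ A → T.IsEdge s(w a, w b)) : ∃ T', HexMove T T' := by
  obtain ⟨r, hr⟩ := exists_strictMono_rotation hw
  obtain ⟨B, hB⟩ := hA.rotate r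
  obtain ⟨C, hC⟩ := hA
  refine exists_hexMove_of_hexPair T hr (fun k => ?_) hB ?_
  · have := hs (k + r)
    rwa [add_right_comm] at this
  · rw [Finset.image_image]
    intro e he
    obtain ⟨f, hf, rfl⟩ := Finset.mem_image.1 he
    induction f using Sym2.ind with
    | _ a b =>
      have key : ∀ a b : Fin 6, a ≠ b → b ≠ a + 1 → a ≠ b + 1 →
        ∃ c d, Cyclic a c b ∧ Cyclic b d a := by decide
      obtain ⟨h1, h2, h3⟩ := hC.left.isDiagonal a b hf
      obtain ⟨c, d, hc, hd⟩ := key a b h1 h2 h3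
      simpa using (h a b hf).mem_diags (hw _ _ _ hc) (hw _ _ _ hd)

end Rotation

/-! ### Both orientations at once, for arguments used together with their mirror images. -/

/-- The cyclic order, or its reverse. -/
def Oriented {n : ℕ} (ε : Bool) (a b c : Fin n) : Prop :=
  if ε then Cyclic a b c else Cyclic c b a

theorem oriented_true {n : ℕ} {a b c : Fin n} : Oriented true a b c ↔ Cyclic a b c := Iff.rfl

theorem oriented_false {n : ℕ} {a b c : Fin n} : Oriented false a b c ↔ Cyclic c b a := by
  simp [Oriented]

theorem oriented_not {n : ℕ} {ε : Bool} {a b c : Fin n} :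
    Oriented (!ε) a b c ↔ Oriented ε c b a := by
  cases ε <;> simp [Oriented]

namespace Oriented

variable {n : ℕ} {ε : Bool} {a b c d : Fin n}

theorem rotate (h : Oriented ε a b c) : Oriented ε b c a := by
  cases ε <;> simp only [oriented_true, oriented_false, Cyclic] at * <;> omega

theorem ne (h : Oriented ε a b c) : a ≠ b := by
  cases ε <;> simp only [oriented_true, oriented_false, Cyclic] at * <;> omega

theorem trans (h : Oriented ε a b c) (h' : Oriented ε a c d) : Oriented ε a b d := by
  cases ε <;> simp only [oriented_true, oriented_false, Cyclic] at * <;> omega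

theorem trans' (h : Oriented ε a b c) (h' : Oriented ε a c d) : Oriented ε b c d := by
  cases ε <;> simp only [oriented_true, oriented_false, Cyclic] at * <;> omega

theorem asymm (h : Oriented ε a b c) (h' : Oriented ε c b a) : False := by
  cases ε <;> simp only [oriented_true, oriented_false, Cyclic] at * <;> omega

theorem cases_of_ne (h : Oriented ε a b c) (ha : d ≠ a) (hb : d ≠ b) (hc : d ≠ c) :
    Oriented ε a d b ∨ Oriented ε b d c ∨ Oriented ε c d a := by
  cases ε <;> simp only [oriented_true, oriented_false, Cyclic] at * <;> omega

end Oriented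

section Moves

variable {m : ℕ} {ε : Bool}

/-- Cutting the circle at `a 0` turns the cyclic order into a linear one, in which the hypotheses
compare consecutive vertices. -/
theorem cyclic_hexagon {a : Fin 6 → Fin (m + 1)} (h1 : Cyclic (a 0) (a 1) (a 2))
    (h2 : Cyclic (a 0) (a 2) (a 3)) (h3 : Cyclic (a 0) (a 3) (a 4))
    (h4 : Cyclic (a 0) (a 4) (a 5)) :
    ∀ i j k, Cyclic i j k → Cyclic (a i) (a j) (a k) := by
  have ht : ∀ {x y z w : Fin (m + 1)}, Cyclic x y z → Cyclic x z w →
      Cyclic x y w ∧ Cyclic y z w := by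
    intro x y z w h h'
    unfold Cyclic at *; omega
  have hr : ∀ {x y z : Fin (m + 1)}, Cyclic x y z → Cyclic y z x := by
    intro x y z h
    unfold Cyclic at *; omega
  have lt : ∀ i j k : Fin 6, i < j → j < k → Cyclic (a i) (a j) (a k) := by
    have h13 := (ht h1 h2).1
    have h14 := (ht h13 h3).1
    have h15 := (ht h14 h4).1
    have h24 := (ht h2 h3).1
    have h25 := (ht h24 h4).1
    have h35 := (ht h3 h4).1
    have zero : ∀ j k : Fin 6, 0 < j → j < k → Cyclic (a 0) (a j) (a k) := by
      intro j k hj hk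
      fin_cases j <;> fin_cases k <;> first | assumption | simp at hj hk
    intro i j k hij hjk
    rcases (Fin.zero_le i).lt_or_eq with hi | rfl
    · exact (ht (zero i j hi hij) (zero j k (hi.trans hij) hjk)).2
    · exact zero j k hij hjk
  rintro i j k (h | h | h)
  · exact lt i j k h.1 h.2
  · exact hr (hr (lt j k i h.1 h.2))
  · exact hr (lt k i j h.1 h.2)

/-- A hexagon with a zig-zag in a triangulation gives a hexagonal move. -/
theorem exists_hexMove_of_zigzag (T : Triangulation m) {a b c d e f : Fin (m + 1)}
    (h1 : Oriented ε a b c) (h2 : Oriented ε a c d) (h3 : Oriented ε a d e)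
    (h4 : Oriented ε a e f) (e1 : T.IsEdge s(a, b)) (e2 : T.IsEdge s(b, c))
    (e3 : T.IsEdge s(c, d)) (e4 : T.IsEdge s(d, e)) (e5 : T.IsEdge s(e, f))
    (e6 : T.IsEdge s(f, a)) (d1 : T.IsEdge s(a, c)) (d2 : T.IsEdge s(c, f))
    (d3 : T.IsEdge s(f, d)) : ∃ T', HexMove T T' := by
  have key : ∀ {w : Fin 6 → Fin (m + 1)} {i j x y : Fin 6}, s(x, y) = s(i, j) →
      T.IsEdge s(w i, w j) → T.IsEdge s(w x, w y) := by
    intro w i j x y h h'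
    rcases Sym2.eq_iff.1 h with ⟨rfl, rfl⟩ | ⟨rfl, rfl⟩
    exacts [h', h'.symm]
  cases ε
  · refine exists_hexMove_of_isMovable T (w := ![a, f, e, d, c, b]) (A := zagzig 0)
      (cyclic_hexagon ?_ ?_ ?_ ?_) ?_ ⟨_, 0, Or.inr (Or.inl ⟨rfl, rfl⟩)⟩ ?_
    iterate 4
      simp only [oriented_false, Cyclic] at h1 h2 h3 h4
      simp [Cyclic]
      omega
    · intro k
      fin_cases k
      exacts [e6.symm, e5.symm, e4.symm, e3.symm, e2.symm, e1.symm]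
    · intro x y hxy
      simp only [zagzig, Finset.mem_insert, Finset.mem_singleton] at hxy
      rcases hxy with h | h | h
      exacts [key h d1, key h d2, key h d3]
  · refine exists_hexMove_of_isMovable T (w := ![a, b, c, d, e, f]) (A := zigzag 0)
      (cyclic_hexagon h1 h2 h3 h4) ?_ ⟨_, 0, Or.inl ⟨rfl, rfl⟩⟩ ?_
    · intro k
      fin_cases k
      exacts [e1, e2, e3, e4, e5, e6]
    · intro x y hxy
      simp only [zigzag, Finset.mem_insert, Finset.mem_singleton] at hxy
      rcases hxy with h | h | h
      exacts [key h d1, key h d2, key h d3]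

/-- A hexagon with an inscribed triangle in a triangulation gives a hexagonal move. -/
theorem exists_hexMove_of_triangle (T : Triangulation m) {a b c d e f : Fin (m + 1)}
    (h1 : Cyclic a b c) (h2 : Cyclic c d e) (h3 : Cyclic e f a) (h4 : Cyclic a c e)
    (e1 : T.IsEdge s(a, b)) (e2 : T.IsEdge s(b, c))
    (e3 : T.IsEdge s(c, d)) (e4 : T.IsEdge s(d, e)) (e5 : T.IsEdge s(e, f))
    (e6 : T.IsEdge s(f, a)) (d1 : T.IsEdge s(a, c)) (d2 : T.IsEdge s(c, e))
    (d3 : T.IsEdge s(e, a)) : ∃ T', HexMove T T' := by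
  have key : ∀ {w : Fin 6 → Fin (m + 1)} {i j x y : Fin 6}, s(x, y) = s(i, j) →
      T.IsEdge s(w i, w j) → T.IsEdge s(w x, w y) := by
    intro w i j x y h h'
    rcases Sym2.eq_iff.1 h with ⟨rfl, rfl⟩ | ⟨rfl, rfl⟩
    exacts [h', h'.symm]
  refine exists_hexMove_of_isMovable T (w := ![a, b, c, d, e, f]) (A := inscribedTriangle 0)
    (cyclic_hexagon h1 ?_ ?_ ?_) ?_ ⟨_, 0, Or.inr (Or.inr ⟨rfl, rfl⟩)⟩ ?_
  iterate 3
    simp [Cyclic] at h1 h2 h3 h4 ⊢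
    omega
  · intro k
    fin_cases k
    exacts [e1, e2, e3, e4, e5, e6]
  · intro x y hxy
    simp only [inscribedTriangle, Finset.mem_insert, Finset.mem_singleton] at hxy
    rcases hxy with h | h | h
    exacts [key h d1, key h d2, key h d3]

namespace Triangulation

variable (T : Triangulation m)

open Classical in
/-- The vertices joined to `i` by an edge. -/
noncomputable def neighbors (i : Fin (m + 1)) : Finset (Fin (m + 1)) :=
  Finset.univ.filter fun j => T.IsEdge s(i, j)

variable {T}

theorem mem_neighbors {i j : Fin (m + 1)} : j ∈ T.neighbors i ↔ T.IsEdge s(i, j) := by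
  simp [neighbors]

theorem IsEdge.exists_oriented_apex {a b x : Fin (m + 1)} (h : T.IsEdge s(a, b))
    (hx : Oriented ε a x b) : ∃ k, Oriented ε a k b ∧ T.IsEdge s(a, k) ∧ T.IsEdge s(k, b) := by
  cases ε
  · obtain ⟨k, hk, h1, h2⟩ := h.symm.exists_apex (oriented_false.1 hx)
    exact ⟨k, oriented_false.2 hk, h2.symm, h1.symm⟩
  · exact h.exists_apex hx

theorem IsEdge.not_oriented {a b c d : Fin (m + 1)} (h : T.IsEdge s(a, b))
    (h' : T.IsEdge s(c, d)) (hc : Oriented ε a c b) (hd : Oriented ε b d a) : False := by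
  cases ε
  · exact h.symm.not_cyclic h' (oriented_false.1 hc) (oriented_false.1 hd)
  · exact h.not_cyclic h' hc hd

/-- If `i` is a vertex of maximal degree and the triangle `i p q` has a side of the polygon
`ip`, and a diagonal `pq`, then a hexagonal move is possible. -/
theorem exists_hexMove_of_side (hm : 1 ≤ m) {i p q : Fin (m + 1)}
    (hmax : ∀ j, (T.neighbors j).card ≤ (T.neighbors i).card)
    (hip : T.IsEdge s(i, p)) (hpq : T.IsEdge s(p, q)) (hiq : T.IsEdge s(i, q))
    (ho : Oriented ε i p q) (hside : ∀ x, ¬ Oriented ε i x p)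
    (hdiag : ∃ x, Oriented ε p x q) : ∃ T', HexMove T T' := by
  obtain ⟨x, hx⟩ := hdiag
  obtain ⟨r, hr, hpr, hrq⟩ := hpq.exists_oriented_apex hx
  have hpqi := ho.rotate
  have hqip := hpqi.rotate
  have hipr := (hr.trans hpqi).rotate.rotate
  by_cases hq : ∃ x, Oriented ε q x i
  · obtain ⟨x, hx⟩ := hq
    obtain ⟨s, hs, hqs, hsi⟩ := hiq.symm.exists_oriented_apex hx
    have hsip := hs.trans' hqip
    have hpqs := (hs.trans hqip).rotate.rotate
    have hqsr := (hr.trans' hpqs).rotate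
    have hrsi := (hr.trans hpqs).trans' hsip.rotate.rotate
    -- The pentagon i, p, r, q, s is triangulated by its diagonals from q. A further triangle on pr
    -- or on si makes it a hexagon with the zig-zag r, p, q, i or p, q, i, s.
    by_cases h1 : ∃ x, Oriented ε p x r
    · obtain ⟨x, hx⟩ := h1
      obtain ⟨t, ht, hpt, htr⟩ := hpr.exists_oriented_apex hx
      exact exists_hexMove_of_zigzag (ε := !ε) T (oriented_not.2 ht) (oriented_not.2 hipr)
        (oriented_not.2 hrsi.rotate) (oriented_not.2 hqsr) htr.symm hpt.symm hip.symm
        hsi.symm hqs.symm hrq.symm hpr.symm hpq hiq.symm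
    by_cases h2 : ∃ x, Oriented ε s x i
    · obtain ⟨x, hx⟩ := h2
      obtain ⟨t, ht, hst, hti⟩ := hsi.exists_oriented_apex hx
      exact exists_hexMove_of_zigzag T hr hpqs (ht.trans hsip).rotate.rotate
        (ht.trans' hsip).rotate.rotate hpr hrq hqs hst hti hip hpq hiq.symm hsi.symm
    exfalso
    -- With ip and si sides, `i` has at most three neighbours, whereas q has at least four.
    have hi : T.neighbors i ⊆ {p, q, s} := by
      intro x hx
      rw [mem_neighbors] at hx
      simp only [Finset.mem_insert, Finset.mem_singleton]
      by_contra! h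
      rcases ho.cases_of_ne (hx.ne hm).symm h.1 h.2.1 with hc | hc | hc
      · exact hside x hc
      · exact hpq.not_oriented hx.symm hc hqip
      · rcases hs.cases_of_ne h.2.1 h.2.2 (hx.ne hm).symm with hc' | hc' | hc'
        · exact hqs.not_oriented hx.symm hc' hs.rotate
        · exact h2 ⟨x, hc'⟩
        · exact hc.asymm hc'
    have hq : {i, p, r, s} ⊆ T.neighbors q := by
      intro x hx
      simp only [Finset.mem_insert, Finset.mem_singleton] at hx
      rw [mem_neighbors]
      rcases hx with rfl | rfl | rfl | rfl
      exacts [hiq.symm, hpq.symm, hrq.symm, hqs]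
    have h3 := (Finset.card_le_card hi).trans Finset.card_le_three
    have h4 : ({i, p, r, s} : Finset (Fin (m + 1))).card = 4 := by
      have := ho.ne
      have := hipr.rotate.ne
      have := hipr.rotate.rotate.ne.symm
      have := hrsi.ne
      have := hrsi.rotate.ne.symm
      have := hsip.rotate.rotate.ne
      simp [*]
    have := (Finset.card_le_card hq).trans (hmax q)
    omega
  · exfalso
    -- With ip and iq sides, `i` is an ear of degree 2, whereas p has the neighbours i, q and r.
    have hi : T.neighbors i ⊆ {p, q} := by
      intro x hx
      rw [mem_neighbors] at hx
      simp only [Finset.mem_insert, Finset.mem_singleton]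
      by_contra! h
      rcases ho.cases_of_ne (hx.ne hm).symm h.1 h.2 with hc | hc | hc
      · exact hside x hc
      · exact hpq.not_oriented hx.symm hc hqip
      · exact hq ⟨x, hc⟩
    have hp : {i, q, r} ⊆ T.neighbors p := by
      intro x hx
      simp only [Finset.mem_insert, Finset.mem_singleton] at hx
      rw [mem_neighbors]
      rcases hx with rfl | rfl | rfl
      exacts [hip.symm, hpq, hpr]
    have h2 := (Finset.card_le_card hi).trans Finset.card_le_two
    have h3 : ({i, q, r} : Finset (Fin (m + 1))).card = 3 :=
      Finset.card_eq_three.2 ⟨i, q, r, hqip.ne.symm, hipr.rotate.rotate.ne.symm,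
        hr.rotate.ne.symm, rfl⟩
    have := (Finset.card_le_card hp).trans (hmax p)
    omega

/-- A diagonal that is not incident to `i` gives a triangle at `i` whose opposite side is a
diagonal. -/
theorem exists_triangle (n : ℕ) {i : Fin (m + 1)} : ∀ p q : Fin (m + 1),
    (Finset.univ.filter fun x => Cyclic p x q).card = n → T.IsEdge s(p, q) → Cyclic p i q →
    (∃ r, Cyclic q r p) → ∃ p q, T.IsEdge s(p, q) ∧ Cyclic p i q ∧ T.IsEdge s(i, p) ∧
      T.IsEdge s(i, q) ∧ ∃ r, Cyclic q r p := by
  induction n using Nat.strong_induction_on with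
  | _ n ih =>
    intro p q hn h hi hr
    obtain ⟨k, hk, h1, h2⟩ := h.exists_apex hi
    -- Unless the apex is `i`, replace pq by the side of the triangle pkq that separates `i` from
    -- the third vertex. That vertex witnesses that the new edge is again a diagonal, and k leaves
    -- the counted arc.
    rcases (show i = k ∨ Cyclic p i k ∨ Cyclic k i q by unfold Cyclic at *; omega)
      with rfl | hc | hc
    · exact ⟨p, q, h, hi, h1.symm, h2, hr⟩
    · refine ih _ ?_ p k rfl h1 hc ⟨q, by unfold Cyclic at *; omega⟩
      rw [← hn]
      refine Finset.card_lt_card (Finset.ssubset_iff_of_subset ?_ |>.2 ⟨k, ?_, ?_⟩)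
      · intro x hx
        simp only [Finset.mem_filter, Finset.mem_univ, true_and] at *
        unfold Cyclic at *; omega
      · simpa using hk
      · rw [Finset.mem_filter]
        unfold Cyclic; omega
    · refine ih _ ?_ k q rfl h2 hc ⟨p, by unfold Cyclic at *; omega⟩
      rw [← hn]
      refine Finset.card_lt_card (Finset.ssubset_iff_of_subset ?_ |>.2 ⟨k, ?_, ?_⟩)
      · intro x hx
        simp only [Finset.mem_filter, Finset.mem_univ, true_and] at *
        unfold Cyclic at *; omega
      · simpa using hk
      · rw [Finset.mem_filter]
        unfold Cyclic; omega

theorem exists_hexMove_of_not_isFan (hm : 1 ≤ m) (hT : ¬ T.IsFan) : ∃ T', HexMove T T' := by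
  obtain ⟨i, -, hmax⟩ := Finset.univ.exists_max_image (fun i => (T.neighbors i).card)
    Finset.univ_nonempty
  replace hmax := fun j => hmax j (Finset.mem_univ j)
  unfold IsFan at hT
  push Not at hT
  obtain ⟨e, he, hie⟩ := hT i
  have hpq : ∃ p q, T.IsEdge s(p, q) ∧ Cyclic p i q ∧ ∃ r, Cyclic q r p := by
    induction e using Sym2.ind with
    | _ a b =>
      simp only [Sym2.mem_iff, not_or] at hie
      have hd := T.isDiagonal _ he
      obtain ⟨h1, h2⟩ := isDiagonal_iff.1 hd
      rcases cyclic_or_cyclic (Ne.symm hie.1) hie.2 (by simpa using hd.1) with hc | hc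
      · exact ⟨a, b, Or.inl he, hc, h2⟩
      · exact ⟨b, a, IsEdge.symm (Or.inl he), hc, h1⟩
  obtain ⟨p', q', h', hi', hr'⟩ := hpq
  obtain ⟨p, q, hpq, hi, hip, hiq, r, hr⟩ := exists_triangle _ p' q' rfl h' hi' hr'
  by_cases hp : ∃ x, Cyclic p x i
  · by_cases hq : ∃ x, Cyclic i x q
    · obtain ⟨x, hx⟩ := hp
      obtain ⟨y, hy⟩ := hq
      obtain ⟨a, ha, ha1, ha2⟩ := hip.symm.exists_apex hx
      obtain ⟨b, hb, hb1, hb2⟩ := hiq.exists_apex hy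
      obtain ⟨c, hc, hc1, hc2⟩ := hpq.symm.exists_apex hr
      exact exists_hexMove_of_triangle T ha hb hc hi ha1 ha2 hb1 hb2 hc1 hc2 hip.symm hiq hpq.symm
    · push Not at hq
      -- Here iq is a side, so p and q exchange roles; the case of a side ip is the mirror image.
      exact exists_hexMove_of_side (ε := true) hm hmax hiq hpq.symm hip
        (oriented_true.2 (by unfold Cyclic at *; omega)) hq ⟨r, hr⟩
  · push Not at hp
    exact exists_hexMove_of_side (ε := false) hm hmax hip hpq hiq
      (oriented_false.2 (by unfold Cyclic at *; omega)) (fun x hx => hp x (oriented_false.1 hx))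
      ⟨r, oriented_false.2 hr⟩

end Triangulation

end Moves

/-! ### Fibres of the colouring map over fans and non-fans. -/

section Fibres

variable {m : ℕ}

theorem ncard_fibre_eq_one_of_isFan (hm : 2 ≤ m) {T : Triangulation m} (hT : T.IsFan) :
    (coloring hm ⁻¹' {coloring hm T}).ncard = 1 := by
  obtain ⟨i, hi⟩ := hT
  exact coloring_preimage_ncard_eq_one hm (i := i) fun j hj =>
    (coloring_eq_iff hm T _).1 rfl _ _ (T.isEdge_of_fan hi hj.symm)

theorem isFan_of_ncard_fibre_eq_one (hm : 2 ≤ m) {y : Model (ZMod 2) m} {T : Triangulation m}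
    (hT : coloring hm T = y) (h : (coloring hm ⁻¹' {y}).ncard = 1) : T.IsFan := by
  by_contra hfan
  obtain ⟨T', hT'⟩ := Triangulation.exists_hexMove_of_not_isFan (by omega) hfan
  obtain ⟨S, hS⟩ := Set.ncard_eq_one.1 h
  have h1 : T ∈ coloring hm ⁻¹' {y} := hT
  have h2 : T' ∈ coloring hm ⁻¹' {y} := (hT'.coloring_eq hm).trans hT
  rw [hS, Set.mem_singleton_iff] at h1 h2
  exact hT'.ne (h1.trans h2.symm)

end Fibres

end TypeA

theorem mainTheorem4 {m : ℕ} (hm : 2 ≤ m) :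
    (∀ y : TypeA.Model (ZMod 2) m, (∃ i, y.color i = TypeA.colOne (ZMod 2)) →
      ((TypeA.coloring hm ⁻¹' {y}).ncard = 1 ↔
        ∃ i : Fin (m + 1), ∀ j : Fin (m + 1), j ≠ i → y.color i ≠ y.color j)) ∧
    (∀ T : TypeA.Triangulation m,
      ((¬ ∃ T' : TypeA.Triangulation m, TypeA.HexMove T T') ↔ T.IsFan) ∧
      ((TypeA.coloring hm ⁻¹' {TypeA.coloring hm T}).ncard = 1 ↔ T.IsFan)) := by
  refine ⟨fun y _ => ⟨fun h => ?_, fun ⟨i, hi⟩ => ?_⟩, fun T => ⟨⟨fun h => ?_, ?_⟩, ?_, ?_⟩⟩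
  -- The single triangulation over `y` is a fan, and the colour of its centre occurs once.
  · obtain ⟨T, hT⟩ := Set.ncard_eq_one.1 h
    have hT : TypeA.coloring hm T = y := by
      have : T ∈ TypeA.coloring hm ⁻¹' {y} := by rw [hT]; exact Set.mem_singleton T
      exact this
    obtain ⟨i, hi⟩ := TypeA.isFan_of_ncard_fibre_eq_one hm hT h
    exact ⟨i, fun j hj =>
      (TypeA.coloring_eq_iff hm T y).1 hT _ _ (T.isEdge_of_fan hi hj.symm)⟩
  · exact TypeA.coloring_preimage_ncard_eq_one hm hi
  · by_contra hfan
    exact h (TypeA.Triangulation.exists_hexMove_of_not_isFan (by omega) hfan)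
  · rintro hfan ⟨T', hT'⟩
    exact hT'.not_isFan hfan
  · exact TypeA.isFan_of_ncard_fibre_eq_one hm rfl
  · exact TypeA.ncard_fibre_eq_one_of_isFan hm
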